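/- Let $n>m>0$ be integers with $\gcd(n,m)=1$. Call a polynomial over $\mathbb C$ Schur stable if all its complex roots lie in the open unit disc. For $\mathbb K\in\{\mathbb R,\mathbb C\}$ let $\mathbb P^2_{\mathbb K}$ be the projective plane over $\mathbb K$, regard $\mathbb P^2_{\mathbb R}$ as a subset of $\mathbb P^2_{\mathbb C}$ in the canonical way, and put $$\Omega_n=\{[a:b:c]\in\mathbb P^2_{\mathbb C}:\ a\neq 0,\ a\zeta^n+b\zeta^m+c \text{ is Schur stable}\},\qquad \mathcal C=\{[1:u:v]\in\mathbb P^2_{\mathbb R}:\ |u|+|v|<1\}.$$ For real $u\ne0$ and $v\neq 0$ let $$\omega(u,v)=\frac{n\arccos\left(\frac{u^2+v^2-1}{2u|v|}\right)+m\arccos\left(\frac{1-u^2+v^2}{2|v|}\right)}{2\pi},$$ where $\arccos$ is extended to $\mathbb R$ by the value $0$ on $(1,\infty)$ and $\pi$ on $(-\infty,-1)$ (the sets below are the same if one requires instead that both arguments lie in $[-1,1]$), and define the subsets of $\mathbb P^2_{\mathbb R}$ $$\begin{aligned} \Gamma_0&=\{[1:u:v]: u\ge 0,\ v\ge 0,\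 u+v<1\}, & \Delta_0&=\{[1:u:v]: u>0,\ v>0,\ u+v\ge 1,\ 2\omega(u,v)>n-1\},\\ \Gamma_1&=\{[1:u:v]: u\ge 0,\ v\le 0,\ u-v<1\}, & \Delta_1&=\{[1:u:v]: u>0,\ v<0,\ u-v\ge 1,\ 2\omega(u,v)>n-1\}. \end{aligned}$$ Then the following hold. For all non-zero real numbers $x,y$: $[1:x:y]\in\Gamma_{n\bmod 2}$ if and only if $[1:x:-y],\,[1:-x:y],\,[1:-x:-y]\in\mathcal C$, $x>0$ and $(-1)^n y>0$. Moreover, for all real numbers $x,y$: (i) if $n$ is even, then $[1:x:y]\in\Delta_0$ if and only if $[1:-x:y]\in(\Omega_n\cap\mathbb P^2_{\mathbb R})\setminus\mathcal C$ and $x>0$; (ii) if $n$ is odd and $m$ is even, then $[1:x:y]\in\Delta_1$ if and only if $[1:-x:-y]\in(\Omega_n\cap\mathbb P^2_{\mathbb R})\setminus\mathcal C$, $x>0$ and $y<0$; (iii) if $n$ and $m$ are odd, then $[1:x:y]\in\Delta_1$ if and only if $[1:x:-y]\in(\Omega_n\cap\mathbb P^2_{\mathbb R})\setminus\mathcal C$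 and $y<0$. -/

import Mathlib

namespace TrinomialStability

open scoped LinearAlgebra.Projectivization

/-- The projective plane over a field `K`. -/
abbrev Plane (K : Type) [Field K] : Type := ℙ K (Fin 3 → K)

lemma vec_ne_zero {K : Type} [Field K] {a : K} (b c : K) (ha : a ≠ 0) :
    (![a, b, c] : Fin 3 → K) ≠ 0 :=
  fun h => ha (by simpa using congrFun h 0)

/-- The point `[1 : u : v]` of the projective plane. -/
def pt {K : Type} [Field K] (u v : K) : Plane K :=
  Projectivization.mk K ![1, u, v] (vec_ne_zero u v one_ne_zero)

/-- The trinomial `a ζ ^ n + b ζ ^ m + c`. -/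
noncomputable def trinomial (n m : ℕ) (a b c : ℂ) : Polynomial ℂ :=
  Polynomial.C a * Polynomial.X ^ n + Polynomial.C b * Polynomial.X ^ m + Polynomial.C c

/-- Schur stability: every complex root lies in the open unit disc. -/
def IsSchurStable (p : Polynomial ℂ) : Prop :=
  ∀ z : ℂ, p.IsRoot z → ‖z‖ < 1

/-- The stability region: the points `[a : b : c]`, `a ≠ 0`, of the complex projective plane whose
trinomial `a ζ ^ n + b ζ ^ m + c` is Schur stable. -/
def Omega (n m : ℕ) : Set (Plane ℂ) :=
  {p | ∃ (a b c : ℂ) (ha : a ≠ 0),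
    p = Projectivization.mk ℂ ![a, b, c] (vec_ne_zero b c ha) ∧
      IsSchurStable (trinomial n m a b c)}

/-- The coordinatewise inclusion `ℝ ^ 3 → ℂ ^ 3`. -/
noncomputable def realVec : (Fin 3 → ℝ) →ₛₗ[Complex.ofRealHom] (Fin 3 → ℂ) where
  toFun w i := (w i : ℂ)
  map_add' _ _ := by ext; simp
  map_smul' _ _ := by ext; simp

lemma realVec_injective : Function.Injective realVec := fun _ _ h =>
  funext fun i => Complex.ofReal_injective (congrFun h i)

/-- The canonical map of the real projective plane into the complex one. -/
noncomputable def realPlane : Plane ℝ → Plane ℂ :=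
  Projectivization.map realVec realVec_injective

/-- The real part `Ω ∩ ℙ²(ℝ)` of the stability region, as a set of real points. -/
def OmegaReal (n m : ℕ) : Set (Plane ℝ) :=
  realPlane ⁻¹' Omega n m

/-- The Cohn domain. -/
def Cohn : Set (Plane ℝ) :=
  {p | ∃ u v : ℝ, p = pt u v ∧ |u| + |v| < 1}

/-- The number `ω(u, v)`. The total function `Real.arccos` is `0` to the right of `1` and `π` to
the left of `-1`. In the sets `Delta0`, `Delta1` below this convention adds no points: where
`|u| + |v| ≥ 1` and an argument leaves `[-1, 1]`, one gets `2 ω = 0` or `2 ω = m`,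
hence `2 ω ≤ n - 1` for `0 < m < n`. -/
noncomputable def omega (n m : ℕ) (u v : ℝ) : ℝ :=
  (n * Real.arccos ((u ^ 2 + v ^ 2 - 1) / (2 * u * |v|)) +
    m * Real.arccos ((1 - u ^ 2 + v ^ 2) / (2 * |v|))) / (2 * Real.pi)

def Gamma0 : Set (Plane ℝ) :=
  {p | ∃ u v : ℝ, p = pt u v ∧ 0 ≤ u ∧ 0 ≤ v ∧ u + v < 1}

def Gamma1 : Set (Plane ℝ) :=
  {p | ∃ u v : ℝ, p = pt u v ∧ 0 ≤ u ∧ v ≤ 0 ∧ u - v < 1}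

/-- `Gamma n` is `Γ_{n mod 2}`. -/
def Gamma (n : ℕ) : Set (Plane ℝ) :=
  if n % 2 = 0 then Gamma0 else Gamma1

def Delta0 (n m : ℕ) : Set (Plane ℝ) :=
  {p | ∃ u v : ℝ, p = pt u v ∧ 0 < u ∧ 0 < v ∧ 1 ≤ u + v ∧ (n : ℝ) - 1 < 2 * omega n m u v}

def Delta1 (n m : ℕ) : Set (Plane ℝ) :=
  {p | ∃ u v : ℝ, p = pt u v ∧ 0 < u ∧ v < 0 ∧ 1 ≤ u - v ∧ (n : ℝ) - 1 < 2 * omega n m u v}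

end TrinomialStability

open TrinomialStability

namespace TrinomialStability

/-! After a choice of signs the trinomial is `z ^ n - σ x z ^ m + y` with `x, y > 0`, `σ = ±1`.
Writing `z = exp t * w` with `‖w‖ = 1`, the root equation becomes `w ^ n + V = U σ w ^ m`, where `U,
V > 0` decrease to `0` as `t` grows. This is a triangle with sides `1`, `U`, `V`; its angles force
`exp (2 π i ω) = σ ^ n (-1) ^ m = (-1) ^ (n - 1)` (`exp_omega_of_root`). Conversely, by coprimality,
a triangle with this phase comes from some `w` (`exists_root_of_exp_omega`). So, where triangles
exist, roots of modulus `exp t` occur exactly when `2 ω` is congruent to `n - 1` mod `2`.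

Along this path `2 ω` is at most `n` wherever a triangle exists and ends at the value `n`. If it
starts above `n - 1` it stays there (`lt_omegaPath`), and no root has modulus `≥ 1`. If it starts at
or below `n - 1`, the intermediate value theorem produces the value `n - 1`, hence a root of modulus
`≥ 1`. -/

/-! ### Affine coordinates. -/

lemma pt_eq_pt_iff {K : Type} [Field K] {u v u' v' : K} :
    pt u v = pt u' v' ↔ u = u' ∧ v = v' := by
  constructor
  · intro h
    obtain ⟨a, ha⟩ := (Projectivization.mk_eq_mk_iff' K _ _ _ _).1 h
    have h0 := congrFun ha 0
    have h1 := congrFun ha 1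
    have h2 := congrFun ha 2
    simp at h0 h1 h2
    subst h0
    simp at h1 h2
    exact ⟨h1.symm, h2.symm⟩
  · rintro ⟨rfl, rfl⟩
    rfl

lemma pt_mem_cohn_iff {u v : ℝ} : pt u v ∈ Cohn ↔ |u| + |v| < 1 := by
  constructor
  · rintro ⟨u', v', h, h'⟩
    obtain ⟨rfl, rfl⟩ := pt_eq_pt_iff.1 h
    exact h'
  · exact fun h => ⟨u, v, rfl, h⟩

lemma pt_mem_gamma0_iff {u v : ℝ} : pt u v ∈ Gamma0 ↔ 0 ≤ u ∧ 0 ≤ v ∧ u + v < 1 := by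
  constructor
  · rintro ⟨u', v', h, h'⟩
    obtain ⟨rfl, rfl⟩ := pt_eq_pt_iff.1 h
    exact h'
  · exact fun h => ⟨u, v, rfl, h⟩

lemma pt_mem_gamma1_iff {u v : ℝ} : pt u v ∈ Gamma1 ↔ 0 ≤ u ∧ v ≤ 0 ∧ u - v < 1 := by
  constructor
  · rintro ⟨u', v', h, h'⟩
    obtain ⟨rfl, rfl⟩ := pt_eq_pt_iff.1 h
    exact h'
  · exact fun h => ⟨u, v, rfl, h⟩

lemma pt_mem_delta0_iff {n m : ℕ} {u v : ℝ} : pt u v ∈ Delta0 n m ↔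
    0 < u ∧ 0 < v ∧ 1 ≤ u + v ∧ (n : ℝ) - 1 < 2 * omega n m u v := by
  constructor
  · rintro ⟨u', v', h, h'⟩
    obtain ⟨rfl, rfl⟩ := pt_eq_pt_iff.1 h
    exact h'
  · exact fun h => ⟨u, v, rfl, h⟩

lemma pt_mem_delta1_iff {n m : ℕ} {u v : ℝ} : pt u v ∈ Delta1 n m ↔
    0 < u ∧ v < 0 ∧ 1 ≤ u - v ∧ (n : ℝ) - 1 < 2 * omega n m u v := by
  constructor
  · rintro ⟨u', v', h, h'⟩
    obtain ⟨rfl, rfl⟩ := pt_eq_pt_iff.1 h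
    exact h'
  · exact fun h => ⟨u, v, rfl, h⟩

lemma realPlane_pt (u v : ℝ) : realPlane (pt u v) = pt (u : ℂ) (v : ℂ) := by
  unfold realPlane pt
  rw [Projectivization.map_mk]
  congr 1
  ext i
  fin_cases i <;> simp [realVec]

lemma pt_mem_omegaReal_iff {n m : ℕ} {u v : ℝ} : pt u v ∈ OmegaReal n m ↔
    ∀ z : ℂ, z ^ n + u * z ^ m + v = 0 → ‖z‖ < 1 := by
  unfold OmegaReal
  rw [Set.mem_preimage, realPlane_pt]
  constructor
  · rintro ⟨a, b, c, ha, h, hs⟩ z hz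
    obtain ⟨k, hk⟩ := (Projectivization.mk_eq_mk_iff' ℂ _ _ _ _).1 h
    have h0 := congrFun hk 0
    have h1 := congrFun hk 1
    have h2 := congrFun hk 2
    simp at h0 h1 h2
    apply hs z
    have hk0 : k ≠ 0 := by rintro rfl; simp at h0
    have : k * (a * z ^ n + b * z ^ m + c) = 0 := by
      rw [← hz, ← h1, ← h2]
      linear_combination (z ^ n) * h0
    simpa [trinomial, hk0] using this
  · intro h
    refine ⟨1, u, v, one_ne_zero, rfl, fun z hz => h z ?_⟩
    simpa [trinomial] using hz

/-! ### Triangles with sides `1`, `u`, `v`. -/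

/-- The cosine of the angle opposite to the side `1` in the triangle with sides `1`, `u`, `v`. -/
noncomputable def cosOne (u v : ℝ) : ℝ := (u ^ 2 + v ^ 2 - 1) / (2 * u * v)

/-- The cosine of the angle opposite to the side `u` in the triangle with sides `1`, `u`, `v`. -/
noncomputable def cosMid (u v : ℝ) : ℝ := (1 - u ^ 2 + v ^ 2) / (2 * v)

lemma omega_eq {n m : ℕ} {u v : ℝ} (hv : 0 < v) : 2 * omega n m u v =
    (n * Real.arccos (cosOne u v) + m * Real.arccos (cosMid u v)) / Real.pi := by
  unfold omega cosOne cosMid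
  rw [abs_of_pos hv]
  have := Real.pi_pos
  field_simp

lemma omega_abs (n m : ℕ) (u v : ℝ) : omega n m u |v| = omega n m u v := by
  simp [omega]

variable {u v : ℝ}

lemma cosOne_le_one_iff (hu : 0 < u) (hv : 0 < v) : cosOne u v ≤ 1 ↔ |u - v| ≤ 1 := by
  unfold cosOne
  rw [div_le_one (by positivity), ← sq_le_one_iff_abs_le_one]
  constructor <;> intro h <;> linarith

lemma neg_one_le_cosOne_iff (hu : 0 < u) (hv : 0 < v) : -1 ≤ cosOne u v ↔ 1 ≤ u + v := by
  unfold cosOne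
  rw [le_div_iff₀ (by positivity)]
  constructor <;> intro h <;> nlinarith

lemma cosMid_le_one_iff (hu : 0 < u) (hv : 0 < v) : cosMid u v ≤ 1 ↔ |1 - v| ≤ u := by
  unfold cosMid
  rw [div_le_one (by positivity), ← abs_of_pos hu, ← sq_le_sq, abs_of_pos hu]
  constructor <;> intro h <;> linarith

lemma neg_one_le_cosMid_iff (hu : 0 < u) (hv : 0 < v) : -1 ≤ cosMid u v ↔ u ≤ 1 + v := by
  unfold cosMid
  rw [le_div_iff₀ (by positivity)]
  constructor <;> intro h <;> nlinarith

/-- The law of sines, squared. -/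
lemma one_sub_cosMid_sq (hu : 0 < u) (hv : 0 < v) :
    1 - cosMid u v ^ 2 = u ^ 2 * (1 - cosOne u v ^ 2) := by
  unfold cosMid cosOne
  field_simp
  ring

/-- The sides `1` and `u` project onto the side `v` and fill it. -/
lemma cosMid_add (hu : 0 < u) (hv : 0 < v) : cosMid u v + u * cosOne u v = v := by
  unfold cosMid cosOne
  field_simp
  ring

/-- No proper triangle exists here, so the angles take the clamped values `π` and `0`; the next two
lemmas treat the other two degenerate regimes. -/
lemma two_omega_of_add_le (n m : ℕ) (hu : 0 < u) (hv : 0 < v) (h : u + v ≤ 1) :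
    2 * omega n m u v = n := by
  have h1 : cosOne u v ≤ -1 := by
    unfold cosOne
    rw [div_le_iff₀ (by positivity)]
    nlinarith
  have h2 : 1 ≤ cosMid u v := by
    unfold cosMid
    rw [one_le_div (by positivity)]
    nlinarith
  rw [omega_eq hv, Real.arccos_of_le_neg_one h1, Real.arccos_of_one_le h2]
  have := Real.pi_pos
  field_simp
  ring

lemma two_omega_of_one_add_le_right (n m : ℕ) (hu : 0 < u) (hv : 0 < v) (h : 1 + u ≤ v) :
    2 * omega n m u v = 0 := by
  have h1 : 1 ≤ cosOne u v := by
    unfold cosOne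
    rw [one_le_div (by positivity)]
    nlinarith
  have h2 : 1 ≤ cosMid u v := by
    unfold cosMid
    rw [one_le_div (by positivity)]
    nlinarith
  rw [omega_eq hv, Real.arccos_of_one_le h1, Real.arccos_of_one_le h2]
  simp

lemma two_omega_of_one_add_le_left (n m : ℕ) (hu : 0 < u) (hv : 0 < v) (h : 1 + v ≤ u) :
    2 * omega n m u v = m := by
  have h1 : 1 ≤ cosOne u v := by
    unfold cosOne
    rw [one_le_div (by positivity)]
    nlinarith
  have h2 : cosMid u v ≤ -1 := by
    unfold cosMid
    rw [div_le_iff₀ (by positivity)]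
    nlinarith
  rw [omega_eq hv, Real.arccos_of_one_le h1, Real.arccos_of_le_neg_one h2]
  have := Real.pi_pos
  field_simp
  ring

/-- The two cosines have nonnegative sum, so the angles add up to at most `π`; weights `m ≤ n` then
give at most `n π`. -/
lemma two_omega_le {n m : ℕ} (hmn : m ≤ n) (hu : 0 < u) (hv : 0 < v) (h : |1 - u| ≤ v) :
    2 * omega n m u v ≤ n := by
  have hsum : 0 ≤ cosOne u v + cosMid u v := by
    have : cosOne u v + cosMid u v = (u + 1) * (v ^ 2 - (1 - u) ^ 2) / (2 * u * v) := by
      unfold cosMid cosOne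
      field_simp
      ring
    rw [this]
    have h2 : (1 - u) ^ 2 ≤ v ^ 2 := sq_le_sq' (by linarith [neg_le_of_abs_le h]) (le_of_abs_le h)
    have : 0 ≤ v ^ 2 - (1 - u) ^ 2 := by linarith
    positivity
  have hang : Real.arccos (cosOne u v) + Real.arccos (cosMid u v) ≤ Real.pi := by
    have := Real.antitone_arccos (show -cosMid u v ≤ cosOne u v by linarith)
    rw [Real.arccos_neg] at this
    linarith
  rw [omega_eq hv, div_le_iff₀ Real.pi_pos]
  have h0 := Real.arccos_nonneg (cosMid u v)
  have hmn' : (m : ℝ) ≤ n := by exact_mod_cast hmn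
  nlinarith [(Nat.cast_nonneg n : (0 : ℝ) ≤ n)]

/-! ### Roots on the unit circle and the phase of `ω`. -/

/-- The unit vectors along the sides of the triangle with sides `1`, `u`, `v` multiply up to the
unit vector of argument `2 π ω`. -/
lemma exp_arccos_pow_mul (n m : ℕ) (hv : 0 < v) :
    Complex.exp (Real.arccos (cosOne u v) * Complex.I) ^ n *
      Complex.exp (Real.arccos (cosMid u v) * Complex.I) ^ m =
    Complex.exp ((2 * omega n m u v * Real.pi : ℝ) * Complex.I) := by
  rw [omega_eq hv, div_mul_cancel₀ _ Real.pi_pos.ne', ← Complex.exp_nat_mul, ← Complex.exp_nat_mul,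
    ← Complex.exp_add]
  congr 1
  push_cast
  ring

lemma exp_arccos_of_norm_eq_one {w : ℂ} {c : ℝ} (hw : ‖w‖ = 1) (him : 0 ≤ w.im)
    (hc : w.re = c) : Complex.exp (Real.arccos c * Complex.I) = w := by
  have hsq : w.re ^ 2 + w.im ^ 2 = 1 := by
    have := Complex.sq_norm w
    rw [hw, Complex.normSq_apply] at this
    linarith
  have h1 : -1 ≤ c := by nlinarith
  have h2 : c ≤ 1 := by nlinarith
  have hs : √(1 - c ^ 2) = w.im := by
    rw [show 1 - c ^ 2 = w.im ^ 2 by rw [← hc]; linarith, Real.sqrt_sq him]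
  apply Complex.ext
  · rw [Complex.exp_ofReal_mul_I_re, Real.cos_arccos h1 h2, hc]
  · rw [Complex.exp_ofReal_mul_I_im, Real.sin_arccos, hs]

/-- By the law of cosines the unit vectors at the two angles are `σ w ^ m` and `-conj (w ^ n)`. In
the product of their `n`-th and `m`-th powers, `w` cancels against its conjugate. The sign of the
imaginary part fixes the orientation, since `arccos` only sees angles in `[0, π]`. -/
lemma exp_omega_of_root_of_im_nonneg {n m : ℕ} {σ w : ℂ} (hu : 0 < u) (hv : 0 < v)
    (hσ : σ = 1 ∨ σ = -1) (hw : ‖w‖ = 1) (h : w ^ n + v = u * (σ * w ^ m))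
    (him : 0 ≤ (σ * w ^ m).im) :
    Complex.exp ((2 * omega n m u v * Real.pi : ℝ) * Complex.I) = σ ^ n * (-1) ^ m := by
  have hσn : ‖σ‖ = 1 := by rcases hσ with rfl | rfl <;> simp
  have hP : ‖σ * w ^ m‖ = 1 := by simp [hσn, hw]
  have hQ : ‖w ^ n‖ = 1 := by simp [hw]
  have hPs : (σ * w ^ m).re ^ 2 + (σ * w ^ m).im ^ 2 = 1 := by
    have := Complex.sq_norm (σ * w ^ m)
    rw [hP, Complex.normSq_apply] at this
    linarith
  have hQs : (w ^ n).re ^ 2 + (w ^ n).im ^ 2 = 1 := by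
    have := Complex.sq_norm (w ^ n)
    rw [hQ, Complex.normSq_apply] at this
    linarith
  have hre : (w ^ n).re + v = u * (σ * w ^ m).re := by
    have := congrArg Complex.re h
    rwa [Complex.add_re, Complex.re_ofReal_mul, Complex.ofReal_re] at this
  have hi : (w ^ n).im = u * (σ * w ^ m).im := by
    have := congrArg Complex.im h
    rwa [Complex.add_im, Complex.im_ofReal_mul, Complex.ofReal_im, add_zero] at this
  have e1 : Complex.exp (Real.arccos (cosOne u v) * Complex.I) = σ * w ^ m := by
    apply exp_arccos_of_norm_eq_one hP him
    unfold cosOne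
    rw [eq_div_iff (by positivity)]
    generalize (σ * w ^ m).re = a at *
    generalize (σ * w ^ m).im = b at *
    have : (w ^ n).re = u * a - v := by linarith
    rw [this, hi] at hQs
    nlinarith
  have e2 : Complex.exp (Real.arccos (cosMid u v) * Complex.I) =
      -(starRingEnd ℂ) (w ^ n) := by
    apply exp_arccos_of_norm_eq_one
    · rw [norm_neg, RCLike.norm_conj, hQ]
    · rw [Complex.neg_im, Complex.conj_im, neg_neg, hi]
      positivity
    · rw [Complex.neg_re, Complex.conj_re]
      unfold cosMid
      rw [eq_div_iff (by positivity)]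
      generalize (σ * w ^ m).re = a at *
      generalize (σ * w ^ m).im = b at *
      have : u ^ 2 = (u * a) ^ 2 + (u * b) ^ 2 := by linear_combination -u ^ 2 * hPs
      rw [← hre, ← hi] at this
      nlinarith
  have hww : w * (starRingEnd ℂ) w = 1 := by
    rw [Complex.mul_conj, Complex.normSq_eq_norm_sq, hw]
    simp
  rw [← exp_arccos_pow_mul n m hv, e1, e2, map_pow, mul_pow, neg_pow, ← pow_mul, ← pow_mul,
    mul_comm n m]
  calc σ ^ n * w ^ (m * n) * ((-1) ^ m * (starRingEnd ℂ) w ^ (m * n))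
      = σ ^ n * (-1) ^ m * (w * (starRingEnd ℂ) w) ^ (m * n) := by rw [mul_pow]; ring
    _ = _ := by rw [hww, one_pow, mul_one]

/-- The coefficients are real, so conjugating `w` reverses the orientation of the triangle. -/
lemma exp_omega_of_root {n m : ℕ} {σ w : ℂ} (hu : 0 < u) (hv : 0 < v)
    (hσ : σ = 1 ∨ σ = -1) (hw : ‖w‖ = 1) (h : w ^ n + v = u * (σ * w ^ m)) :
    Complex.exp ((2 * omega n m u v * Real.pi : ℝ) * Complex.I) = σ ^ n * (-1) ^ m := by
  rcases le_total 0 (σ * w ^ m).im with him | him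
  · exact exp_omega_of_root_of_im_nonneg hu hv hσ hw h him
  · have hσc : (starRingEnd ℂ) σ = σ := by rcases hσ with rfl | rfl <;> simp
    have hc : σ * (starRingEnd ℂ) w ^ m = (starRingEnd ℂ) (σ * w ^ m) := by
      rw [map_mul, map_pow, hσc]
    refine exp_omega_of_root_of_im_nonneg (w := (starRingEnd ℂ) w) hu hv hσ
      (by rw [RCLike.norm_conj, hw]) ?_ ?_
    · have := congrArg (starRingEnd ℂ) h
      simpa [hσc] using this
    · rw [hc, Complex.conj_im]
      linarith

lemma triangle_of_root {n m : ℕ} {σ w : ℂ} (hu : 0 < u) (hv : 0 < v)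
    (hσ : σ = 1 ∨ σ = -1) (hw : ‖w‖ = 1) (h : w ^ n + v = u * (σ * w ^ m)) :
    |1 - u| ≤ v ∧ 1 ≤ u + v := by
  have hσn : ‖σ‖ = 1 := by rcases hσ with rfl | rfl <;> simp
  have hP : ‖u * (σ * w ^ m)‖ = u := by simp [hσn, hw, abs_of_pos hu]
  have hQ : ‖w ^ n‖ = 1 := by simp [hw]
  have hV : ‖(v : ℂ)‖ = v := by simp [abs_of_pos hv]
  have h1 := norm_sub_norm_le (u * (σ * w ^ m)) (w ^ n)
  have h2 := norm_sub_norm_le (w ^ n) (u * (σ * w ^ m))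
  have h3 := norm_sub_le (u * (σ * w ^ m)) (v : ℂ)
  rw [norm_sub_rev] at h2
  rw [show u * (σ * w ^ m) - w ^ n = v by rw [← h]; ring, hP, hQ, hV] at h1 h2
  rw [show u * (σ * w ^ m) - v = w ^ n by rw [← h]; ring, hP, hQ, hV] at h3
  exact ⟨abs_le.2 ⟨by linarith, by linarith⟩, h3⟩

/-- Bézout: with `n a + m b = 1`, the element `P ^ b * Q ^ a` works. -/
lemma exists_pow_eq_of_coprime {G : Type*} [CommGroup G] {n m : ℕ} (h : Nat.gcd n m = 1)
    {P Q : G} (hPQ : P ^ n = Q ^ m) : ∃ w : G, w ^ m = P ∧ w ^ n = Q := by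
  have hb : (1 : ℤ) = n * n.gcdA m + m * n.gcdB m := by
    rw [← Nat.gcd_eq_gcd_ab, h]; rfl
  have hPQ' : P ^ (n : ℤ) = Q ^ (m : ℤ) := by exact_mod_cast hPQ
  refine ⟨P ^ n.gcdB m * Q ^ n.gcdA m, ?_, ?_⟩
  · rw [← zpow_natCast, mul_zpow, ← zpow_mul, ← zpow_mul, mul_comm (n.gcdA m), zpow_mul Q, ← hPQ',
      ← zpow_mul, ← zpow_add, show n.gcdB m * m + n * n.gcdA m = 1 by rw [hb]; ring, zpow_one]
  · rw [← zpow_natCast, mul_zpow, ← zpow_mul, ← zpow_mul, mul_comm (n.gcdB m), zpow_mul P, hPQ',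
      ← zpow_mul, ← zpow_add, show m * n.gcdB m + n.gcdA m * n = 1 by rw [hb]; ring, zpow_one]

lemma exists_root_of_exp_omega {n m : ℕ} {σ : ℂ} (hcop : Nat.gcd n m = 1) (hu : 0 < u)
    (hv : 0 < v) (hσ : σ = 1 ∨ σ = -1) (h1 : |u - v| ≤ 1) (h2 : 1 ≤ u + v)
    (h : Complex.exp ((2 * omega n m u v * Real.pi : ℝ) * Complex.I) = σ ^ n * (-1) ^ m) :
    ∃ w : ℂ, ‖w‖ = 1 ∧ w ^ n + v = u * (σ * w ^ m) := by
  have a1 := (cosOne_le_one_iff hu hv).2 h1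
  rw [abs_le] at h1
  have a2 := (neg_one_le_cosOne_iff hu hv).2 h2
  have a3 : cosMid u v ≤ 1 :=
    (cosMid_le_one_iff hu hv).2 (abs_le.2 ⟨by linarith, by linarith⟩)
  have a4 : -1 ≤ cosMid u v := (neg_one_le_cosMid_iff hu hv).2 (by linarith)
  have hσ2 : σ * σ = 1 := by rcases hσ with rfl | rfl <;> simp
  have hσn : ‖σ‖ = 1 := by rcases hσ with rfl | rfl <;> simp
  set A := Complex.exp (Real.arccos (cosOne u v) * Complex.I) with hA
  set B := Complex.exp (Real.arccos (cosMid u v) * Complex.I) with hB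
  have hAn : ‖A‖ = 1 := Complex.norm_exp_ofReal_mul_I _
  have hBn : ‖B‖ = 1 := Complex.norm_exp_ofReal_mul_I _
  have hB0 : B ≠ 0 := Complex.exp_ne_zero _
  rw [← exp_arccos_pow_mul n m hv, ← hA, ← hB] at h
  -- `P` and `Q` are the intended values of `w ^ m` and `w ^ n`; the group `Circle` allows the
  -- negative Bézout exponents.
  let P : Circle := ⟨σ * A, by simp [Submonoid.unitSphere, hσn, hAn]⟩
  let Q : Circle := ⟨-B⁻¹, by simp [Submonoid.unitSphere, hBn]⟩
  have hPQ : P ^ n = Q ^ m := by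
    apply Circle.ext
    change (σ * A) ^ n = (-B⁻¹) ^ m
    rw [mul_pow, neg_pow, inv_pow, eq_comm, mul_inv_eq_iff_eq_mul₀ (pow_ne_zero _ hB0), mul_assoc, h,
      ← mul_assoc, ← mul_pow, hσ2, one_pow, one_mul]
  obtain ⟨w, hwP, hwQ⟩ := exists_pow_eq_of_coprime hcop hPQ
  refine ⟨w, w.norm_coe, ?_⟩
  have eP : (w : ℂ) ^ m = σ * A := by
    rw [← Circle.coe_pow, hwP]
  have eQ : (w : ℂ) ^ n = -B⁻¹ := by
    rw [← Circle.coe_pow, hwQ]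
  have hBi : B⁻¹ = (starRingEnd ℂ) B := by
    rw [Complex.inv_def, Complex.normSq_eq_norm_sq, hBn]
    simp
  have hs : √(1 - cosMid u v ^ 2) = u * √(1 - cosOne u v ^ 2) := by
    rw [one_sub_cosMid_sq hu hv, Real.sqrt_mul (sq_nonneg u), Real.sqrt_sq hu.le]
  rw [eP, eQ, hBi, ← mul_assoc σ, hσ2, one_mul]
  apply Complex.ext
  · rw [Complex.add_re, Complex.neg_re, Complex.conj_re, Complex.re_ofReal_mul, Complex.ofReal_re,
      hA, hB, Complex.exp_ofReal_mul_I_re, Complex.exp_ofReal_mul_I_re, Real.cos_arccos a2 a1,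
      Real.cos_arccos a4 a3]
    linarith [cosMid_add hu hv]
  · rw [Complex.add_im, Complex.neg_im, Complex.conj_im, Complex.im_ofReal_mul, Complex.ofReal_im,
      hA, hB, Complex.exp_ofReal_mul_I_im, Complex.exp_ofReal_mul_I_im, Real.sin_arccos,
      Real.sin_arccos, hs]
    ring

/-! ### The scaling path. -/

/-- The coefficient of `w ^ m`, up to sign, after substituting `exp t * w` into the trinomial and
making it monic. -/
noncomputable def scaleMid (n m : ℕ) (x t : ℝ) : ℝ := x * Real.exp (((m : ℝ) - n) * t)

/-- The constant coefficient after substituting `exp t * w` into the trinomial and making it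
monic. -/
noncomputable def scaleConst (n : ℕ) (y t : ℝ) : ℝ := y * Real.exp (-(n * t))

variable {n m : ℕ} {x y t : ℝ}

lemma scaleMid_pos (hx : 0 < x) : 0 < scaleMid n m x t := mul_pos hx (Real.exp_pos _)

lemma scaleConst_pos (hy : 0 < y) : 0 < scaleConst n y t := mul_pos hy (Real.exp_pos _)

lemma scaleMid_mul_exp : scaleMid n m x t * Real.exp t ^ n = x * Real.exp t ^ m := by
  rw [scaleMid, mul_assoc, ← Real.exp_nat_mul, ← Real.exp_nat_mul, ← Real.exp_add]
  congr 2
  ring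

lemma scaleConst_mul_exp : scaleConst n y t * Real.exp t ^ n = y := by
  rw [scaleConst, mul_assoc, ← Real.exp_nat_mul, ← Real.exp_add]
  simp

lemma hasDerivAt_scaleMid : HasDerivAt (scaleMid n m x) (((m : ℝ) - n) * scaleMid n m x t) t := by
  have h := (((hasDerivAt_id t).const_mul ((m : ℝ) - n)).exp).const_mul x
  refine h.congr_deriv ?_
  simp only [scaleMid, id]
  ring

lemma hasDerivAt_scaleConst : HasDerivAt (scaleConst n y) (-(n * scaleConst n y t)) t := by
  have h := (((hasDerivAt_id t).const_mul (n : ℝ)).neg.exp).const_mul y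
  refine h.congr_deriv ?_
  simp only [scaleConst, id, Pi.neg_apply]
  ring

lemma scaleMid_antitone (hmn : m ≤ n) (hx : 0 < x) : Antitone (scaleMid n m x) := by
  intro s t hst
  have : (m : ℝ) ≤ n := by exact_mod_cast hmn
  unfold scaleMid
  gcongr x * Real.exp ?_
  nlinarith

lemma scaleConst_antitone (hy : 0 < y) : Antitone (scaleConst n y) := by
  intro s t hst
  unfold scaleConst
  gcongr

/-- Twice `ω` along the scaling path. -/
noncomputable def omegaPath (n m : ℕ) (x y t : ℝ) : ℝ :=
  2 * omega n m (scaleMid n m x t) (scaleConst n y t)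

lemma omegaPath_zero : omegaPath n m x y 0 = 2 * omega n m x y := by
  simp [omegaPath, scaleMid, scaleConst]

lemma omegaPath_eq (hy : 0 < y) : omegaPath n m x y = fun t =>
    (n * Real.arccos (cosOne (scaleMid n m x t) (scaleConst n y t)) +
      m * Real.arccos (cosMid (scaleMid n m x t) (scaleConst n y t))) / Real.pi :=
  funext fun _ => omega_eq (scaleConst_pos hy)

lemma continuous_omegaPath (hx : 0 < x) (hy : 0 < y) : Continuous (omegaPath n m x y) := by
  have hU : Continuous (scaleMid n m x) :=
    continuous_iff_continuousAt.2 fun _ => hasDerivAt_scaleMid.continuousAt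
  have hV : Continuous (scaleConst n y) :=
    continuous_iff_continuousAt.2 fun _ => hasDerivAt_scaleConst.continuousAt
  have hU0 : ∀ t, scaleMid n m x t ≠ 0 := fun t => (scaleMid_pos hx).ne'
  have hV0 : ∀ t, scaleConst n y t ≠ 0 := fun t => (scaleConst_pos hy).ne'
  rw [omegaPath_eq hy]
  unfold cosOne cosMid
  refine Continuous.div_const (.add (.mul continuous_const (Real.continuous_arccos.comp
    (.div (by fun_prop) (by fun_prop) ?_))) (.mul continuous_const (Real.continuous_arccos.comp
    (.div (by fun_prop) (by fun_prop) ?_)))) _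
  · intro t; simp [hU0, hV0]
  · intro t; simp [hV0]

/-- In a non-degenerate triangle, `ω` increases along the scaling path. -/
lemma hasDerivAt_omegaPath (hx : 0 < x) (hy : 0 < y)
    (h1 : |scaleMid n m x t - scaleConst n y t| < 1)
    (h2 : 1 < scaleMid n m x t + scaleConst n y t) :
    ∃ d, 0 ≤ d ∧ HasDerivAt (omegaPath n m x y) d t := by
  have hu : 0 < scaleMid n m x t := scaleMid_pos hx
  have hv : 0 < scaleConst n y t := scaleConst_pos hy
  have hdU := hasDerivAt_scaleMid (n := n) (m := m) (x := x) (t := t)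
  have hdV := hasDerivAt_scaleConst (n := n) (y := y) (t := t)
  rw [omegaPath_eq hy]
  generalize scaleMid n m x = U at *
  generalize scaleConst n y = V at *
  have hd1 : HasDerivAt (fun s => cosOne (U s) (V s))
      ((m * U t ^ 2 - m * V t ^ 2 - (2 * n - m)) / (2 * U t * V t)) t := by
    refine (((hdU.pow 2).add (hdV.pow 2)).sub_const 1 |>.div
      ((hdU.const_mul 2).mul hdV) (show 2 * U t * V t ≠ 0 by positivity)).congr_deriv ?_
    simp only [Pi.add_apply, Pi.pow_apply, Pi.mul_apply]
    field_simp
    push_cast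
    ring
  have hd2 : HasDerivAt (fun s => cosMid (U s) (V s))
      ((n - (2 * m - n) * U t ^ 2 - n * V t ^ 2) / (2 * V t)) t := by
    refine (((hdU.pow 2).const_sub 1).add (hdV.pow 2) |>.div
      (hdV.const_mul 2) (by positivity)).congr_deriv ?_
    simp only [Pi.add_apply, Pi.pow_apply]
    field_simp
    push_cast
    ring
  have h1' := abs_lt.1 h1
  have c1 : cosOne (U t) (V t) < 1 := by
    unfold cosOne
    rw [div_lt_one (by positivity)]
    nlinarith
  have c2 : -1 < cosOne (U t) (V t) := by
    unfold cosOne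
    rw [lt_div_iff₀ (by positivity)]
    nlinarith
  have c3 : cosMid (U t) (V t) < 1 := by
    unfold cosMid
    rw [div_lt_one (by positivity)]
    nlinarith
  have c4 : -1 < cosMid (U t) (V t) := by
    unfold cosMid
    rw [lt_div_iff₀ (by positivity)]
    nlinarith
  have hf := ((((Real.hasDerivAt_arccos c2.ne' c1.ne).comp t hd1).const_mul (n : ℝ)).add
    (((Real.hasDerivAt_arccos c4.ne' c3.ne).comp t hd2).const_mul (m : ℝ))).div_const Real.pi
  refine ⟨_, ?_, hf⟩
  rw [one_sub_cosMid_sq hu hv, Real.sqrt_mul (sq_nonneg _), Real.sqrt_sq hu.le]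
  have hs : 0 < √(1 - cosOne (U t) (V t) ^ 2) := Real.sqrt_pos.2 (by nlinarith)
  generalize √(1 - cosOne (U t) (V t) ^ 2) = s at *
  generalize U t = a at *
  generalize V t = b at *
  clear hf hd1 hd2 c1 c2 c3 c4 hdU hdV
  have hab : (1 - a) ^ 2 ≤ b ^ 2 := sq_le_sq' (by linarith) (by linarith)
  -- The numerator of the derivative equals `(n - m a) ^ 2 + m n (b ^ 2 - (1 - a) ^ 2)`, and `|1 -
  -- a| ≤ b` in a triangle.
  have hnum : 0 ≤ (n : ℝ) ^ 2 + m ^ 2 * a ^ 2 - m * n * (1 + a ^ 2 - b ^ 2) := by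
    nlinarith [sq_nonneg (n - m * a : ℝ), mul_nonneg (mul_nonneg (Nat.cast_nonneg (α := ℝ) m)
      (Nat.cast_nonneg (α := ℝ) n)) (sub_nonneg.2 hab)]
  apply div_nonneg _ Real.pi_pos.le
  have : n * (-(1 / s) * ((m * a ^ 2 - m * b ^ 2 - (2 * n - m)) / (2 * a * b))) +
      m * (-(1 / (a * s)) * ((n - (2 * m - n) * a ^ 2 - n * b ^ 2) / (2 * b))) =
      ((n : ℝ) ^ 2 + m ^ 2 * a ^ 2 - m * n * (1 + a ^ 2 - b ^ 2)) / (a * b * s) := by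
    field_simp
    ring
  rw [this]
  positivity

/-- Once `2 ω` exceeds `n - 1`, it stays above `n - 1` along the scaling path. -/
lemma lt_omegaPath (hm : 0 < m) (hmn : m < n) (hx : 0 < x) (hy : 0 < y)
    (h0 : (n : ℝ) - 1 < omegaPath n m x y 0) (ht : 0 ≤ t) : (n : ℝ) - 1 < omegaPath n m x y t := by
  by_contra hcon
  have hc := continuous_omegaPath (n := n) (m := m) hx hy
  -- Take the first time `s` at which `2 ω ≤ n - 1`. Before it the triangle is non-degenerate, so `2
  -- ω` is monotone on `[0, s]`, a contradiction.
  have hK : IsCompact (Set.Icc 0 t ∩ {s | omegaPath n m x y s ≤ (n : ℝ) - 1}) :=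
    isCompact_Icc.inter_right (isClosed_le hc continuous_const)
  obtain ⟨s, ⟨⟨hs0, hst⟩, hs⟩, hmin⟩ := hK.exists_isLeast ⟨t, ⟨ht, le_rfl⟩, not_lt.1 hcon⟩
  rw [Set.mem_ofPred_eq] at hs
  have hlt : ∀ r, 0 ≤ r → r < s → (n : ℝ) - 1 < omegaPath n m x y r := by
    intro r hr hrs
    by_contra hr'
    exact absurd (hmin ⟨⟨hr, by linarith⟩, not_lt.1 hr'⟩) (not_le.2 hrs)
  have hmn' : (m : ℝ) + 1 ≤ n := by exact_mod_cast hmn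
  have hm' : (0 : ℝ) < m := by exact_mod_cast hm
  have hU0 : ∀ r, 0 < scaleMid n m x r := fun _ => scaleMid_pos hx
  have hV0 : ∀ r, 0 < scaleConst n y r := fun _ => scaleConst_pos hy
  have hsum : 1 < scaleMid n m x s + scaleConst n y s := by
    by_contra h
    have := two_omega_of_add_le n m (hU0 s) (hV0 s) (not_lt.1 h)
    unfold omegaPath at hs
    linarith
  -- The degenerate values `0` and `m` do not exceed `n - 1`, and `U + V` was at least as large
  -- before `s` as at `s`.
  have hder : ∀ r ∈ interior (Set.Icc 0 s), ∃ d, 0 ≤ d ∧ HasDerivAt (omegaPath n m x y) d r := by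
    intro r hr
    rw [interior_Icc] at hr
    have hr' := hlt r hr.1.le hr.2
    apply hasDerivAt_omegaPath hx hy
    · rw [abs_lt]
      constructor
      · by_contra h
        have := two_omega_of_one_add_le_right n m (hU0 r) (hV0 r) (by linarith)
        unfold omegaPath at hr'
        linarith
      · by_contra h
        have := two_omega_of_one_add_le_left n m (hU0 r) (hV0 r) (by linarith)
        unfold omegaPath at hr'
        linarith
    · linarith [scaleMid_antitone hmn.le hx hr.2.le, scaleConst_antitone (n := n) hy hr.2.le]
  have hmono : MonotoneOn (omegaPath n m x y) (Set.Icc 0 s) := by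
    refine monotoneOn_of_deriv_nonneg (convex_Icc 0 s) hc.continuousOn ?_ ?_
    · intro r hr
      obtain ⟨d, -, hd⟩ := hder r hr
      exact hd.differentiableAt.differentiableWithinAt
    · intro r hr
      obtain ⟨d, hd0, hd⟩ := hder r hr
      rwa [hd.deriv]
  linarith [hmono ⟨le_rfl, hs0⟩ ⟨hs0, le_rfl⟩ hs0]

/-! ### The stability criterion for positive coefficients. -/

/-- In every parity case the phase of a root is that of `2 ω = n - 1`, so one argument serves all
three. -/
lemma sign_pow_mul_eq {σ : ℂ} (hmn : m < n)
    (hσ : σ = 1 ∧ Odd (n + m) ∨ σ = -1 ∧ Odd n ∧ Odd m) :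
    σ ^ n * (-1) ^ m = (-1) ^ (n - 1) := by
  obtain ⟨k, rfl⟩ : ∃ k, n = k + 1 := ⟨n - 1, by omega⟩
  rw [Nat.add_sub_cancel]
  rcases hσ with ⟨rfl, h⟩ | ⟨rfl, h, h'⟩
  · rw [one_pow, one_mul]
    rcases Nat.even_or_odd m with hm | hm
    · have : Even k := by grind
      rw [hm.neg_one_pow, this.neg_one_pow]
    · have : Odd k := by grind
      rw [hm.neg_one_pow, this.neg_one_pow]
  · have : Even k := by grind
    rw [h.neg_one_pow, h'.neg_one_pow, this.neg_one_pow]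
    simp

lemma sign_eq {σ : ℝ} (hσ : σ = 1 ∧ Odd (n + m) ∨ σ = -1 ∧ Odd n ∧ Odd m) :
    (σ : ℂ) = 1 ∧ Odd (n + m) ∨ (σ : ℂ) = -1 ∧ Odd n ∧ Odd m := by
  rcases hσ with ⟨rfl, h⟩ | ⟨rfl, h⟩ <;> simp [h]

lemma root_scale_iff {σ w : ℂ} : (Real.exp t * w) ^ n - x * (σ * (Real.exp t * w) ^ m) + y = 0 ↔
    w ^ n + scaleConst n y t = scaleMid n m x t * (σ * w ^ m) := by
  have hE : (Real.exp t : ℂ) ^ n ≠ 0 := by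
    exact_mod_cast pow_ne_zero n (Real.exp_pos t).ne'
  have e1 : (scaleMid n m x t : ℂ) * (Real.exp t : ℂ) ^ n = x * (Real.exp t : ℂ) ^ m := by
    exact_mod_cast scaleMid_mul_exp
  have e2 : (scaleConst n y t : ℂ) * (Real.exp t : ℂ) ^ n = y := by
    exact_mod_cast scaleConst_mul_exp
  have key : (Real.exp t * w) ^ n - x * (σ * (Real.exp t * w) ^ m) + y = (Real.exp t : ℂ) ^ n *
      (w ^ n + scaleConst n y t - scaleMid n m x t * (σ * w ^ m)) := by
    rw [mul_pow, mul_pow]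
    linear_combination σ * w ^ m * e1 - e2
  rw [key, mul_eq_zero, or_iff_right hE, sub_eq_zero]

theorem norm_lt_one_of_lt_omega {σ : ℝ} (hm : 0 < m) (hmn : m < n)
    (hσ : σ = 1 ∧ Odd (n + m) ∨ σ = -1 ∧ Odd n ∧ Odd m) (hx : 0 < x) (hy : 0 < y)
    (h : (n : ℝ) - 1 < 2 * omega n m x y) {z : ℂ} (hz : z ^ n - x * (σ * z ^ m) + y = 0) :
    ‖z‖ < 1 := by
  by_contra hz1
  rw [not_lt] at hz1
  obtain ⟨t, ht, hzt⟩ : ∃ t, 0 ≤ t ∧ Real.exp t = ‖z‖ :=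
    ⟨Real.log ‖z‖, Real.log_nonneg hz1, Real.exp_log (by linarith)⟩
  obtain ⟨w, hw, rfl⟩ : ∃ w : ℂ, ‖w‖ = 1 ∧ z = Real.exp t * w := by
    have hz0 : ‖z‖ ≠ 0 := by linarith
    have hz0' : (‖z‖ : ℂ) ≠ 0 := by exact_mod_cast hz0
    refine ⟨z / ‖z‖, by simp [hz0], ?_⟩
    rw [hzt]
    field_simp
  rw [root_scale_iff] at hz
  have hσ' := sign_eq hσ
  have hσ1 : (σ : ℂ) = 1 ∨ (σ : ℂ) = -1 := hσ'.imp And.left And.left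
  have hu : 0 < scaleMid n m x t := scaleMid_pos hx
  have hv : 0 < scaleConst n y t := scaleConst_pos hy
  have hlow := lt_omegaPath hm hmn hx hy (by rwa [omegaPath_zero]) ht
  have hup := two_omega_le hmn.le hu hv (triangle_of_root hu hv hσ1 hw hz).1
  have hexp := exp_omega_of_root hu hv hσ1 hw hz
  rw [sign_pow_mul_eq hmn hσ'] at hexp
  rw [show 2 * omega n m (scaleMid n m x t) (scaleConst n y t) = omegaPath n m x y t from rfl]
    at hup hexp
  have hn : ((n - 1 : ℕ) : ℝ) = n - 1 := by
    rw [Nat.cast_sub (by omega)]; simp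
  -- The phase of a root makes `(2 ω - (n - 1)) π` a multiple of `2 π`, but it lies in `(0, π]`.
  have hone : Complex.exp (((omegaPath n m x y t - (n - 1)) * Real.pi : ℝ) * Complex.I) = 1 := by
    have : (((omegaPath n m x y t - (n - 1)) * Real.pi : ℝ) * Complex.I : ℂ) =
        (omegaPath n m x y t * Real.pi : ℝ) * Complex.I -
          (n - 1 : ℕ) * (Real.pi * Complex.I) := by
      rw [← hn]
      push_cast
      ring
    rw [this, Complex.exp_sub, Complex.exp_nat_mul, Complex.exp_pi_mul_I, hexp, div_self]
    simp
  have hre := congrArg Complex.re hone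
  rw [Complex.exp_ofReal_mul_I_re, Complex.one_re] at hre
  have hpi := Real.pi_pos
  have h1 : 0 < (omegaPath n m x y t - (n - 1)) * Real.pi := by
    apply mul_pos _ hpi; linarith
  have h2 : (omegaPath n m x y t - (n - 1)) * Real.pi ≤ Real.pi := by nlinarith
  rw [Real.cos_eq_one_iff_of_lt_of_lt (by linarith) (by linarith)] at hre
  linarith

lemma tendsto_scaleMid (hmn : m < n) :
    Filter.Tendsto (scaleMid n m x) Filter.atTop (nhds 0) := by
  have hmn' : (m : ℝ) - n < 0 := by
    have : (m : ℝ) < n := by exact_mod_cast hmn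
    linarith
  have := (Real.tendsto_exp_atBot.comp
    (Filter.tendsto_id.const_mul_atTop_of_neg hmn')).const_mul x
  rw [mul_zero] at this
  exact this

lemma tendsto_scaleConst (hn : 0 < n) :
    Filter.Tendsto (scaleConst n y) Filter.atTop (nhds 0) := by
  have hn' : -(n : ℝ) < 0 := by
    have : (0 : ℝ) < n := by exact_mod_cast hn
    linarith
  have := (Real.tendsto_exp_atBot.comp
    (Filter.tendsto_id.const_mul_atTop_of_neg hn')).const_mul y
  rw [mul_zero] at this
  refine this.congr fun t => ?_
  simp [scaleConst]

theorem lt_omega_of_stable {σ : ℝ} (hm : 0 < m) (hmn : m < n) (hcop : Nat.gcd n m = 1)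
    (hσ : σ = 1 ∧ Odd (n + m) ∨ σ = -1 ∧ Odd n ∧ Odd m) (hx : 0 < x) (hy : 0 < y)
    (h : ∀ z : ℂ, z ^ n - x * (σ * z ^ m) + y = 0 → ‖z‖ < 1) :
    (n : ℝ) - 1 < 2 * omega n m x y := by
  by_contra hcon
  rw [not_lt, ← omegaPath_zero] at hcon
  have hc := continuous_omegaPath (n := n) (m := m) hx hy
  have hmn' : (m : ℝ) + 1 ≤ n := by exact_mod_cast hmn
  have hm' : (0 : ℝ) < m := by exact_mod_cast hm
  obtain ⟨T, hT, hT0⟩ : ∃ T, scaleMid n m x T + scaleConst n y T < 1 ∧ 0 ≤ T := by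
    have := (tendsto_scaleMid (x := x) hmn).add (tendsto_scaleConst (n := n) (y := y) (by omega))
    rw [add_zero] at this
    exact ((this.eventually_lt_const one_pos).and (Filter.eventually_ge_atTop 0)).exists
  have hTv : omegaPath n m x y T = n :=
    two_omega_of_add_le n m (scaleMid_pos hx) (scaleConst_pos hy) hT.le
  obtain ⟨t, ⟨ht0, -⟩, ht⟩ := intermediate_value_Icc hT0 hc.continuousOn
    (show (n : ℝ) - 1 ∈ Set.Icc _ _ from ⟨hcon, by rw [hTv]; linarith⟩)
  have hu : 0 < scaleMid n m x t := scaleMid_pos hx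
  have hv : 0 < scaleConst n y t := scaleConst_pos hy
  have hσ' := sign_eq hσ
  have hσ1 : (σ : ℂ) = 1 ∨ (σ : ℂ) = -1 := hσ'.imp And.left And.left
  have h1 : 1 ≤ scaleMid n m x t + scaleConst n y t := by
    by_contra h
    have := two_omega_of_add_le n m hu hv (by linarith)
    unfold omegaPath at ht
    linarith
  have h2 : scaleConst n y t ≤ 1 + scaleMid n m x t := by
    by_contra h
    have := two_omega_of_one_add_le_right n m hu hv (by linarith)
    unfold omegaPath at ht
    linarith
  -- If `U > 1 + V` there is no triangle: `2 ω` has the constant value `m`, and reaching `n - 1`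
  -- does not yield a root on the circle of radius `exp t`.
  by_cases h3 : scaleMid n m x t ≤ 1 + scaleConst n y t
  · obtain ⟨w, hw, hroot⟩ := exists_root_of_exp_omega hcop hu hv hσ1
      (abs_le.2 ⟨by linarith, by linarith⟩) h1 (by
        rw [sign_pow_mul_eq hmn hσ', show 2 * omega n m (scaleMid n m x t) (scaleConst n y t) =
          ((n - 1 : ℕ) : ℝ) by rw [Nat.cast_sub (by omega), Nat.cast_one]; exact ht,
          ← Complex.exp_pi_mul_I, ← Complex.exp_nat_mul]
        congr 1
        push_cast
        ring)
    have := h _ (root_scale_iff.2 hroot)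
    rw [norm_mul, hw, mul_one, Complex.norm_real, Real.norm_of_nonneg (Real.exp_pos t).le] at this
    linarith [Real.one_le_exp ht0]
  · rw [not_le] at h3
    have hmeq := two_omega_of_one_add_le_left n m hu hv h3.le
    -- Then `n` and `m` have opposite parity, so `σ = 1` and a positive real root can be sought
    -- instead.
    have hnm : n = m + 1 := by
      have : (n : ℝ) = m + 1 := by unfold omegaPath at ht; linarith
      exact_mod_cast this
    have hσ2 : σ = 1 := by
      rcases hσ with h | ⟨-, h, h'⟩
      · exact h.1
      · grind
    subst hσ2
    -- the trinomial is negative at `exp t` and positive at `exp (max t T)`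
    have hval : ∀ s, Real.exp s ^ n - x * Real.exp s ^ m + y =
        Real.exp s ^ n * (1 + scaleConst n y s - scaleMid n m x s) := by
      intro s
      linear_combination scaleMid_mul_exp (n := n) (m := m) (x := x) (t := s) -
        scaleConst_mul_exp (n := n) (y := y) (t := s)
    have htT : t ≤ max t T := le_max_left _ _
    obtain ⟨s, ⟨hs, -⟩, hs0⟩ := intermediate_value_Icc htT
      (f := fun s => Real.exp s ^ n - x * Real.exp s ^ m + y) (by fun_prop)
      (show (0 : ℝ) ∈ Set.Icc _ _ by
        constructor
        · simp only [hval]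
          exact mul_nonpos_of_nonneg_of_nonpos (by positivity) (by linarith)
        · simp only [hval]
          have := scaleMid_antitone hmn.le hx (le_max_right t T)
          have := scaleConst_pos (n := n) (y := y) (t := max t T) hy
          have := scaleConst_pos (n := n) (y := y) (t := T) hy
          exact mul_nonneg (by positivity) (by linarith))
    have := h (Real.exp s) (by
      rw [Complex.ofReal_one, one_mul]
      exact_mod_cast hs0)
    rw [Complex.norm_real, Real.norm_of_nonneg (Real.exp_pos s).le] at this
    linarith [Real.one_le_exp (ht0.trans hs)]

/-- A monic real trinomial that is not positive at `1` has a real root in `[1, ∞)`. -/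
lemma exists_one_le_root {a b : ℝ} (hmn : m < n) (h : 1 + a + b ≤ 0) :
    ∃ r : ℝ, 1 ≤ r ∧ r ^ n + a * r ^ m + b = 0 := by
  set R : ℝ := 1 + |a| + |b| with hR
  have ha := abs_nonneg a
  have hb := abs_nonneg b
  have hR1 : 1 ≤ R := by linarith
  obtain ⟨r, ⟨hr, -⟩, hr0⟩ := intermediate_value_Icc hR1
    (f := fun r : ℝ => r ^ n + a * r ^ m + b) (by fun_prop)
    (show (0 : ℝ) ∈ Set.Icc _ _ by
      refine ⟨by simpa using h, ?_⟩
      obtain ⟨k, rfl⟩ : ∃ k, n = m + 1 + k := ⟨n - m - 1, by omega⟩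
      have h1 : 1 ≤ R ^ m := one_le_pow₀ hR1
      have h2 : R ^ m * R ≤ R ^ (m + 1 + k) := by
        rw [← pow_succ]; exact pow_le_pow_right₀ hR1 (by omega)
      have h3 : 0 ≤ R ^ m * (a + |a|) := mul_nonneg (by linarith) (by linarith [neg_abs_le a])
      have h4 : |b| ≤ R ^ m * |b| := le_mul_of_one_le_left hb h1
      have h5 : R ^ m * R = R ^ m + R ^ m * |a| + R ^ m * |b| := by rw [hR]; ring
      nlinarith [neg_abs_le b])
  exact ⟨r, hr, hr0⟩

end TrinomialStability

/-! ### Reduction of the sign cases to positive coefficients. -/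

theorem corollary1p9 (n m : ℕ) (hm : 0 < m) (hmn : m < n) (hcop : Nat.gcd n m = 1) :
    (∀ x y : ℝ, x ≠ 0 → y ≠ 0 →
      (pt x y ∈ Gamma n ↔
        ((pt x (-y) ∈ Cohn ∧ pt (-x) y ∈ Cohn ∧ pt (-x) (-y) ∈ Cohn) ∧
          0 < x ∧ 0 < (-1) ^ n * y))) ∧
    (Even n → ∀ x y : ℝ,
      (pt x y ∈ Delta0 n m ↔ pt (-x) y ∈ OmegaReal n m \ Cohn ∧ 0 < x)) ∧
    (Odd n → Even m → ∀ x y : ℝ,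
      (pt x y ∈ Delta1 n m ↔ pt (-x) (-y) ∈ OmegaReal n m \ Cohn ∧ 0 < x ∧ y < 0)) ∧
    (Odd n → Odd m → ∀ x y : ℝ,
      (pt x y ∈ Delta1 n m ↔ pt x (-y) ∈ OmegaReal n m \ Cohn ∧ y < 0)) := by
  refine ⟨fun x y hx hy => ?_, fun hn x y => ?_, fun hn hm2 x y => ?_, fun hn hm2 x y => ?_⟩
  · simp only [pt_mem_cohn_iff, abs_neg, and_self]
    rcases Nat.even_or_odd n with hn | hn
    · rw [Gamma, if_pos (Nat.even_iff.1 hn), pt_mem_gamma0_iff, hn.neg_one_pow, one_mul]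
      constructor
      · rintro ⟨h1, h2, h3⟩
        rw [abs_of_nonneg h1, abs_of_nonneg h2]
        exact ⟨h3, h1.lt_of_ne' hx, h2.lt_of_ne' hy⟩
      · rintro ⟨h3, h1, h2⟩
        rw [abs_of_pos h1, abs_of_pos h2] at h3
        exact ⟨h1.le, h2.le, h3⟩
    · rw [Gamma, if_neg (Nat.not_even_iff_odd.2 hn ∘ Nat.even_iff.2), pt_mem_gamma1_iff,
        hn.neg_one_pow]
      constructor
      · rintro ⟨h1, h2, h3⟩
        rw [abs_of_nonneg h1, abs_of_nonpos h2]
        exact ⟨by linarith, h1.lt_of_ne' hx, by linarith [h2.lt_of_ne hy]⟩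
      · rintro ⟨h3, h1, h2⟩
        rw [abs_of_pos h1, abs_of_neg (by linarith : y < 0)] at h3
        exact ⟨h1.le, by linarith, by linarith⟩
  · have hm2 : Odd m := by
      rw [← Nat.not_even_iff_odd]
      intro hm2
      exact Nat.not_coprime_of_dvd_of_dvd one_lt_two hn.two_dvd hm2.two_dvd hcop
    have hσ : (1 : ℝ) = 1 ∧ Odd (n + m) ∨ (1 : ℝ) = -1 ∧ Odd n ∧ Odd m :=
      Or.inl ⟨rfl, hn.add_odd hm2⟩
    rw [pt_mem_delta0_iff, Set.mem_sdiff, pt_mem_cohn_iff, pt_mem_omegaReal_iff, abs_neg]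
    constructor
    · rintro ⟨hx, hy, hxy, h⟩
      refine ⟨⟨fun z hz => norm_lt_one_of_lt_omega hm hmn hσ hx hy h ?_, ?_⟩, hx⟩
      · rw [← hz]; push_cast; ring
      · rw [abs_of_pos hx, abs_of_pos hy]; linarith
    · rintro ⟨⟨h, hxy⟩, hx⟩
      -- For `y ≤ 0`, lying outside the Cohn domain means `1 - x + y ≤ 0`, which forces a real root
      -- `≥ 1`.
      have hy : 0 < y := by
        by_contra hy
        rw [abs_of_pos hx, abs_of_nonpos (not_lt.1 hy)] at hxy
        obtain ⟨r, hr, hr0⟩ := exists_one_le_root (a := -x) (b := y) hmn (by linarith)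
        have := h r (by exact_mod_cast hr0)
        rw [Complex.norm_real, Real.norm_of_nonneg (by linarith)] at this
        linarith
      rw [abs_of_pos hx, abs_of_pos hy, not_lt] at hxy
      refine ⟨hx, hy, hxy, lt_omega_of_stable hm hmn hcop hσ hx hy fun z hz => h z ?_⟩
      rw [← hz]; push_cast; ring
  · have hσ : (1 : ℝ) = 1 ∧ Odd (n + m) ∨ (1 : ℝ) = -1 ∧ Odd n ∧ Odd m :=
      Or.inl ⟨rfl, hn.add_even hm2⟩
    rw [pt_mem_delta1_iff, Set.mem_sdiff, pt_mem_cohn_iff, pt_mem_omegaReal_iff, abs_neg, abs_neg,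
      ← omega_abs]
    constructor
    · rintro ⟨hx, hy, hxy, h⟩
      rw [abs_of_neg hy] at h
      refine ⟨⟨fun z hz => norm_lt_one_of_lt_omega hm hmn hσ hx (neg_pos.2 hy) h ?_, ?_⟩, hx, hy⟩
      · rw [← hz]; push_cast; ring
      · rw [abs_of_pos hx, abs_of_neg hy]; linarith
    · rintro ⟨⟨h, hxy⟩, hx, hy⟩
      rw [abs_of_pos hx, abs_of_neg hy, not_lt] at hxy
      rw [abs_of_neg hy]
      refine ⟨hx, hy, by linarith,
        lt_omega_of_stable hm hmn hcop hσ hx (neg_pos.2 hy) fun z hz => h z ?_⟩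
      rw [← hz]; push_cast; ring
  · have hσ : (-1 : ℝ) = 1 ∧ Odd (n + m) ∨ (-1 : ℝ) = -1 ∧ Odd n ∧ Odd m :=
      Or.inr ⟨rfl, hn, hm2⟩
    rw [pt_mem_delta1_iff, Set.mem_sdiff, pt_mem_cohn_iff, pt_mem_omegaReal_iff, abs_neg,
      ← omega_abs]
    constructor
    · rintro ⟨hx, hy, hxy, h⟩
      rw [abs_of_neg hy] at h
      refine ⟨⟨fun z hz => norm_lt_one_of_lt_omega hm hmn hσ hx (neg_pos.2 hy) h ?_, ?_⟩, hy⟩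
      · rw [← hz]; push_cast; ring
      · rw [abs_of_pos hx, abs_of_neg hy]; linarith
    · rintro ⟨⟨h, hxy⟩, hy⟩
      -- For `x ≤ 0` the substitution `z = -r`, with both exponents odd, turns the trinomial into
      -- `-(r ^ n + x r ^ m + y)`, whose value at `r = 1` is nonnegative; so there is a real root `≤
      -- -1`.
      have hx : 0 < x := by
        by_contra hx
        rw [abs_of_nonpos (not_lt.1 hx), abs_of_neg hy] at hxy
        obtain ⟨r, hr, hr0⟩ := exists_one_le_root (a := x) (b := y) hmn (by linarith)
        have := h (-r : ℝ) (by
          have : (-r) ^ n + x * (-r) ^ m + -y = 0 := by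
            rw [hn.neg_pow, hm2.neg_pow]; linarith
          exact_mod_cast this)
        rw [Complex.norm_real, norm_neg, Real.norm_of_nonneg (by linarith)] at this
        linarith
      rw [abs_of_pos hx, abs_of_neg hy, not_lt] at hxy
      rw [abs_of_neg hy]
      refine ⟨hx, hy, by linarith,
        lt_omega_of_stable hm hmn hcop hσ hx (neg_pos.2 hy) fun z hz => h z ?_⟩
      rw [← hz]; push_cast; ring
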